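/- Let $n\ge 1$, let $\mathbb{B}^n$ be the open unit ball of $\mathbb{C}^n$ (Euclidean norm), let $d(z)$ be the Euclidean distance from $z$ to $\partial\mathbb{B}^n$, and let $dV_N$ be the Lebesgue measure on $\mathbb{B}^n$ normalized to total mass $1$. Write $z_k=x_k+iy_k$, $\Delta=\sum_{k=1}^n\big(\partial^2/\partial x_k^2+\partial^2/\partial y_k^2\big)$, and, with $f_{z_k}=\frac12(\partial_{x_k}f-i\,\partial_{y_k}f)$ and $f_{\overline z_k}=\frac12(\partial_{x_k}f+i\,\partial_{y_k}f)$, $$\|D_f\|=\Big(\sum_{k=1}^n |f_{z_k}|^2+\sum_{k=1}^n|f_{\overline z_k}|^2\Big)^{1/2}.$$ For an integer $m\ge 2$, $\mathcal{HZ}_m(\mathbb{B}^n)$ is the class of all complex-valued $f\in C^m(\mathbb{B}^n)$ for which there are nonnegative continuous functions $a,b,c:\mathbb{B}^n\to\mathbb{R}$ with $|\Delta f|\le a\,\|D_f\|+b\,|f|+c$ on $\mathbb{B}^n$. For $\nu\ge 0$ and $t>0$, $\mathcal{D}_{\nu,t}(\mathbb{B}^n)$ is the space of all complex-valued $f\in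 C^1(\mathbb{B}^n)$ with $$|f(0)|+\Big(\int_{\mathbb{B}^n}d(z)^{\nu}\,\|D_f(z)\|^{t}\,dV_N(z)\Big)^{1/t}<\infty .$$ Let $\alpha,\gamma\in\mathbb{R}$ with $2\le\alpha\le 2n$ and $\gamma>0$, let $\tau,\eta\ge 0$ be constants, and let $f\in\mathcal{HZ}_3(\mathbb{B}^n)\cap\mathcal{D}_{\gamma,\alpha}(\mathbb{B}^n)$ be a $C^2$ solution of the non-homogeneous Yukawa equation $$\Delta f(z)=\tau f(z)+\eta\,\mathrm{Re}\,f(z),\qquad z\in\mathbb{B}^n .$$ Then for every real $p\ge 2$ the function $|f|^p$ is of class $C^2$ in $\mathbb{B}^n$ (so that $\Delta(|f|^p)$ is a classical Laplacian), the function $d^{pq}\,\Delta(|f|^p)$ is integrable on $\mathbb{B}^n$, and hence $$\int_{\mathbb{B}^n} d(z)^{pq}\,\Delta\big(|f(z)|^p\big)\,dV_N(z)<\infty,\qquad\text{where } q=\frac{2n+\gamma}{\alpha}-1 .$$ -/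

import Mathlib

noncomputable section

namespace YukawaBall

open MeasureTheory Complex

/-- The Hilbert space `ℂⁿ` with its Euclidean norm. -/
abbrev Cn (n : ℕ) : Type := EuclideanSpace ℂ (Fin n)

/-- The open unit ball `𝔹ⁿ` of `ℂⁿ`. -/
def unitBall (n : ℕ) : Set (Cn n) := Metric.ball 0 1

/-- The Euclidean distance `d(z)` from `z` to the boundary of the unit ball. -/
def distBdry {n : ℕ} (z : Cn n) : ℝ := Metric.infDist z (frontier (unitBall n))

/-- The normalized Lebesgue volume measure `dV_N` of the unit ball (total mass one). -/
def normVol (n : ℕ) : Measure (Cn n) :=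
  (volume (unitBall n))⁻¹ • volume.restrict (unitBall n)

/-- The partial derivative `∂f/∂x_k`, where `z_k = x_k + i y_k`. -/
def partialX {n : ℕ} (f : Cn n → ℂ) (k : Fin n) (z : Cn n) : ℂ :=
  fderiv ℝ f z (EuclideanSpace.single k 1)

/-- The partial derivative `∂f/∂y_k`, where `z_k = x_k + i y_k`. -/
def partialY {n : ℕ} (f : Cn n → ℂ) (k : Fin n) (z : Cn n) : ℂ :=
  fderiv ℝ f z (EuclideanSpace.single k I)

/-- The Wirtinger derivative `f_{z_k} = (∂f/∂x_k - i ∂f/∂y_k) / 2`. -/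
def wirtinger {n : ℕ} (f : Cn n → ℂ) (k : Fin n) (z : Cn n) : ℂ :=
  1 / 2 * (partialX f k z - I * partialY f k z)

/-- The conjugate Wirtinger derivative `f_{z̄_k} = (∂f/∂x_k + i ∂f/∂y_k) / 2`. -/
def wirtingerBar {n : ℕ} (f : Cn n → ℂ) (k : Fin n) (z : Cn n) : ℂ :=
  1 / 2 * (partialX f k z + I * partialY f k z)

/-- The Hilbert-Schmidt seminorm `‖D_f(z)‖ = (‖∇f‖² + ‖∇̄f‖²)^{1/2}` with
`∇f = (f_{z_1}, …, f_{z_n})` and `∇̄f = (f_{z̄_1}, …, f_{z̄_n})`. -/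
def normD {n : ℕ} (f : Cn n → ℂ) (z : Cn n) : ℝ :=
  Real.sqrt (∑ k, ‖wirtinger f k z‖ ^ 2 + ∑ k, ‖wirtingerBar f k z‖ ^ 2)

/-- The Dirichlet-type energy integral `∫ d^ν |f|^μ ‖D_f‖^t dV_N`, with values in `[0, ∞]`. -/
def energy {n : ℕ} (f : Cn n → ℂ) (ν μ t : ℝ) : ENNReal :=
  ∫⁻ z, ENNReal.ofReal (distBdry z) ^ ν * ENNReal.ofReal ‖f z‖ ^ μ
    * ENNReal.ofReal (normD f z) ^ t ∂(normVol n)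

/-- The norm `|f(0)| + (∫ d^ν ‖D_f‖^t dV_N)^{1/t}`, with values in `[0, ∞]`. -/
def dirichletNorm {n : ℕ} (ν t : ℝ) (f : Cn n → ℂ) : ENNReal :=
  ENNReal.ofReal ‖f 0‖ + energy f ν 0 t ^ (1 / t)

/-- The Dirichlet-type space `𝒟_{ν,t}(𝔹ⁿ)` (used for `ν ≥ 0` and `t > 0`): functions of class
`C¹` in the ball with finite norm. Only the values of `f` in the ball matter. -/
def MemDirichlet {n : ℕ} (ν t : ℝ) (f : Cn n → ℂ) : Prop :=
  ContDiffOn ℝ 1 f (unitBall n) ∧ dirichletNorm ν t f < ⊤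

/-- The class `ℋ𝒵_m(𝔹ⁿ)` (used for `m ≥ 2`): functions of class `C^m` in the ball satisfying
Heinz's inequality `|Δf| ≤ a ‖D_f‖ + b |f| + c` there, for some nonnegative continuous real
functions `a, b, c` on the ball. -/
def MemHeinz {n : ℕ} (m : ℕ) (f : Cn n → ℂ) : Prop :=
  ContDiffOn ℝ m f (unitBall n) ∧
    ∃ a b c : Cn n → ℝ,
      ContinuousOn a (unitBall n) ∧ ContinuousOn b (unitBall n) ∧ ContinuousOn c (unitBall n) ∧
      ∀ z ∈ unitBall n, 0 ≤ a z ∧ 0 ≤ b z ∧ 0 ≤ c z ∧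
        ‖Laplacian.laplacian f z‖ ≤ a z * normD f z + b z * ‖f z‖ + c z

/-- `f` is a `C²` solution in the ball of the non-homogeneous Yukawa equation
`Δf = τ f + η Re f`. -/
def SolvesYukawa {n : ℕ} (τ η : Cn n → ℝ) (f : Cn n → ℂ) : Prop :=
  ContDiffOn ℝ 2 f (unitBall n) ∧
    ∀ z ∈ unitBall n, Laplacian.laplacian f z = (τ z : ℂ) * f z + (η z : ℂ) * ((f z).re : ℂ)

end YukawaBall

end

/-! Write `d = 1 - ‖z‖`. Differentiating the equation shows that each real directional derivative h
of f satisfies Δh = τh + η Re h. Hence ⟨h, Δh⟩ = τ|h|² + η(Re h)² ≥ 0 and |h|² is subharmonic. The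
sub-mean value inequality on the ball of radius d/2 about z, combined with the finite weighted
α-energy, gives |Df(z)| ≤ C d^{-(2n+γ)/α} = C d^{-(q+1)} (`exists_norm_fderiv_apply_le`).
Integrating along the radius gives |f(z)| ≤ B d^{-q} (`norm_le_of_norm_fderiv_apply_le`).

On the other side, `abs_laplacian_norm_rpow_le` bounds |Δ(|f|^p)| by a multiple of |f|^{p-2}‖D_f‖² +
|f|^p. After multiplication by d^{pq}, the powers of f are absorbed by B, and what remains is
d^{2q}‖D_f‖². Since α ≤ 2n forces q ≥ γ/α, and x² ≤ 1 + x^α, this is at most 1 + d^γ‖D_f‖^α, which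
is integrable by hypothesis.

The sub-mean value inequality comes from averages against the radial weight ρ = (1 - |x|²)₊ rather
than spherical means. As ∇(ρ²) = -4ρx, one integration by parts over the whole space shows that
these averages increase with the radius. -/

open MeasureTheory Filter Topology Set Metric

/-! ### Second-order calculus and the Laplacian -/

section Laplacian

variable {E F G : Type*} [NormedAddCommGroup E] [NormedSpace ℝ E]
  [NormedAddCommGroup F] [NormedSpace ℝ F] [NormedAddCommGroup G] [NormedSpace ℝ G]

/-- The Laplacian is the trace of the second derivative. -/
theorem laplacian_eq_sum_fderiv_fderiv {E : Type*} [NormedAddCommGroup E] [InnerProductSpace ℝ E]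
    [FiniteDimensional ℝ E] {ι : Type*} [Fintype ι] (b : OrthonormalBasis ι ℝ E)
    (f : E → F) (x : E) :
    Laplacian.laplacian f x = ∑ i, fderiv ℝ (fderiv ℝ f) x (b i) (b i) := by
  rw [InnerProductSpace.laplacian_eq_iteratedFDeriv_orthonormalBasis f b]
  simp [iteratedFDeriv_two_apply]

/-- Second-order chain rule. -/
theorem fderiv_fderiv_comp_apply {f : E → F} {Φ : F → G} {x : E}
    (hf : ContDiffAt ℝ 2 f x) (hΦ : ContDiffAt ℝ 2 Φ (f x)) (v w : E) :
    fderiv ℝ (fderiv ℝ (fun y => Φ (f y))) x v w =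
      fderiv ℝ (fderiv ℝ Φ) (f x) (fderiv ℝ f x v) (fderiv ℝ f x w)
        + fderiv ℝ Φ (f x) (fderiv ℝ (fderiv ℝ f) x v w) := by
  have h1 : ∀ᶠ y in 𝓝 x, DifferentiableAt ℝ f y :=
    (hf.eventually (by simp)).mono fun y hy => hy.differentiableAt (by simp)
  have h2 : ∀ᶠ y in 𝓝 x, DifferentiableAt ℝ Φ (f y) :=
    (hf.continuousAt.eventually (hΦ.eventually (by simp))).mono
      fun y hy => hy.differentiableAt (by simp)
  have h3 : fderiv ℝ (fun y => Φ (f y)) =ᶠ[𝓝 x]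
      fun y => (fderiv ℝ Φ (f y)).comp (fderiv ℝ f y) := by
    filter_upwards [h1, h2] with y hy1 hy2
    exact fderiv_comp y hy2 hy1
  have hf' : DifferentiableAt ℝ (fderiv ℝ f) x :=
    (hf.fderiv_right (m := 1) (by norm_num)).differentiableAt (by simp)
  have hΦ' : DifferentiableAt ℝ (fderiv ℝ Φ) (f x) :=
    (hΦ.fderiv_right (m := 1) (by norm_num)).differentiableAt (by simp)
  have h4 := (hΦ'.hasFDerivAt.comp x h1.self_of_nhds.hasFDerivAt).clm_comp hf'.hasFDerivAt
  rw [h3.fderiv_eq]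
  erw [h4.fderiv]
  simp [add_comm]

/-- The Laplacian commutes with directional derivatives. -/
theorem laplacian_fderiv_apply {E : Type*} [NormedAddCommGroup E] [InnerProductSpace ℝ E]
    [FiniteDimensional ℝ E] {f : E → F} {x : E} (hf : ContDiffAt ℝ 3 f x) (v : E) :
    Laplacian.laplacian (fun y => fderiv ℝ f y v) x
      = fderiv ℝ (Laplacian.laplacian f) x v := by
  set b := stdOrthonormalBasis ℝ E
  have hG : ContDiffAt ℝ 2 (fderiv ℝ f) x := hf.fderiv_right (by norm_num)
  have hG' : DifferentiableAt ℝ (fderiv ℝ (fderiv ℝ f)) x :=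
    (hG.fderiv_right (m := 1) (by norm_num)).differentiableAt (by simp)
  have hd : ∀ e : E, ∀ u : E, HasFDerivAt (fun y => fderiv ℝ (fderiv ℝ f) y e u)
      (((ContinuousLinearMap.apply ℝ F u).comp (ContinuousLinearMap.apply ℝ (E →L[ℝ] F) e)).comp
        (fderiv ℝ (fderiv ℝ (fderiv ℝ f)) x)) x := by
    intro e u
    refine ((hG'.hasFDerivAt.clm_apply (hasFDerivAt_const e x)).clm_apply
      (hasFDerivAt_const u x)).congr_fderiv ?_
    ext w
    simp
  have hlap : Laplacian.laplacian f = fun y => ∑ i, fderiv ℝ (fderiv ℝ f) y (b i) (b i) :=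
    funext fun y => laplacian_eq_sum_fderiv_fderiv b f y
  have hsum : HasFDerivAt (fun y => ∑ i, fderiv ℝ (fderiv ℝ f) y (b i) (b i)) _ x :=
    HasFDerivAt.fun_sum fun i _ => hd (b i) (b i)
  rw [laplacian_eq_sum_fderiv_fderiv b, hlap, hsum.fderiv]
  simp only [sum_apply, ContinuousLinearMap.comp_apply,
    ContinuousLinearMap.apply_apply]
  refine Finset.sum_congr rfl fun i _ => ?_
  have h1 : ∀ᶠ y in 𝓝 x, DifferentiableAt ℝ (fderiv ℝ f) y :=
    (hG.eventually (by simp)).mono fun y hy => hy.differentiableAt (by simp)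
  have h2 : fderiv ℝ (fun y => fderiv ℝ f y v) =ᶠ[𝓝 x]
      fun y => (ContinuousLinearMap.apply ℝ F v).comp (fderiv ℝ (fderiv ℝ f) y) := by
    filter_upwards [h1] with y hy
    exact ((ContinuousLinearMap.apply ℝ F v).hasFDerivAt.comp y hy.hasFDerivAt).fderiv
  have h3 : HasFDerivAt (fun y => (ContinuousLinearMap.apply ℝ F v).comp
      (fderiv ℝ (fderiv ℝ f) y)) _ x :=
    (hasFDerivAt_const (ContinuousLinearMap.apply ℝ F v) x).clm_comp hG'.hasFDerivAt
  rw [h2.fderiv_eq, h3.fderiv]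
  -- Third derivatives are permuted in two moves: symmetry of D²f holds near x and can be
  -- differentiated (`h5`, `h6`), and D²(Df) is itself symmetric at x (`h7`).
  have h4 : (fun y => fderiv ℝ (fderiv ℝ f) y (b i) v) =ᶠ[𝓝 x]
      fun y => fderiv ℝ (fderiv ℝ f) y v (b i) := by
    filter_upwards [hf.eventually (by simp)] with y hy
    exact (hy.isSymmSndFDerivAt (by norm_num [minSmoothness])) (b i) v
  have h5 := h4.fderiv_eq (𝕜 := ℝ)
  rw [(hd (b i) v).fderiv, (hd v (b i)).fderiv] at h5
  have h6 := congrArg (fun L => L (b i)) h5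
  have h7 := (hG.isSymmSndFDerivAt (by norm_num [minSmoothness])) (b i) v
  simp only [ContinuousLinearMap.comp_apply, ContinuousLinearMap.apply_apply] at h6
  simp [h6, h7]

/-- The Laplacian of a `C²` function is continuous. -/
theorem continuousOn_laplacian {E : Type*} [NormedAddCommGroup E] [InnerProductSpace ℝ E]
    [FiniteDimensional ℝ E] {f : E → F} {U : Set E} (hU : IsOpen U) (hf : ContDiffOn ℝ 2 f U) :
    ContinuousOn (Laplacian.laplacian f) U := by
  have h1 : ContDiffOn ℝ 1 (fderiv ℝ f) U := hf.fderiv_of_isOpen hU (by norm_num)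
  have h2 : ContinuousOn (fderiv ℝ (fderiv ℝ f)) U := h1.continuousOn_fderiv_of_isOpen hU le_rfl
  rw [funext fun x => laplacian_eq_sum_fderiv_fderiv (stdOrthonormalBasis ℝ E) f x]
  exact continuousOn_finsetSum _ fun i _ =>
    (h2.clm_apply continuousOn_const).clm_apply continuousOn_const

end Laplacian

/-! ### Sub-mean value inequality through a radial weight -/

section SubMeanValue

/-- Squaring removes the kink of the positive part: at 0 the function is O(s²). The squared radial
weight is therefore differentiable across the unit sphere, and integration by parts has no boundary
term. -/
theorem hasDerivAt_sq_max_zero (s : ℝ) :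
    HasDerivAt (fun s : ℝ => (max s 0) ^ 2) (2 * max s 0) s := by
  rcases lt_trichotomy s 0 with h | rfl | h
  · rw [max_eq_right h.le, mul_zero]
    refine (hasDerivAt_const s (0 : ℝ)).congr_of_eventuallyEq ?_
    filter_upwards [Iio_mem_nhds h] with t ht
    simp [max_eq_right (le_of_lt (mem_Iio.1 ht))]
  · have : (fun s : ℝ => (max s 0) ^ 2) =O[𝓝 0] fun s => ‖s - 0‖ ^ 2 := by
      refine Asymptotics.IsBigO.of_bound 1 (Eventually.of_forall fun t => ?_)
      simp only [sub_zero, norm_pow, one_mul, Real.norm_eq_abs]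
      rw [abs_of_nonneg (le_max_right t 0), abs_abs]
      gcongr
      exact max_le (le_abs_self t) (abs_nonneg t)
    simpa [HasDerivAt, HasDerivAtFilter] using this.hasFDerivAt (by norm_num) |>.hasDerivAt
  · rw [max_eq_left h.le]
    have := hasDerivAt_pow 2 s
    refine (this.congr_of_eventuallyEq ?_).congr_deriv (by norm_num)
    filter_upwards [Ioi_mem_nhds h] with t ht
    simp [max_eq_left (le_of_lt (mem_Ioi.1 ht))]

variable {E : Type*} [NormedAddCommGroup E]

/-- The quadratic radial weight supported in the closed unit ball. -/
noncomputable def radialWeight (x : E) : ℝ := max (1 - ‖x‖ ^ 2) 0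

theorem continuous_radialWeight : Continuous (radialWeight : E → ℝ) := by
  unfold radialWeight; fun_prop

theorem radialWeight_nonneg (x : E) : 0 ≤ radialWeight x := le_max_right _ _

theorem radialWeight_le_one (x : E) : radialWeight x ≤ 1 :=
  max_le (by nlinarith [sq_nonneg ‖x‖]) zero_le_one

theorem radialWeight_eq_zero {x : E} (hx : 1 ≤ ‖x‖) : radialWeight x = 0 :=
  max_eq_right (by nlinarith)

theorem hasFDerivAt_sq_radialWeight [InnerProductSpace ℝ E] (x : E) :
    HasFDerivAt (fun y : E => radialWeight y ^ 2) ((-(4 * radialWeight x)) • innerSL ℝ x) x := by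
  have h1 : HasFDerivAt (fun y : E => 1 - ‖y‖ ^ 2) (-(2 • innerSL ℝ x)) x :=
    (hasStrictFDerivAt_norm_sq x).hasFDerivAt.const_sub 1
  have h2 := (hasDerivAt_sq_max_zero (1 - ‖x‖ ^ 2)).comp_hasFDerivAt x h1
  refine h2.congr_fderiv ?_
  ext v
  simp [radialWeight]
  ring

theorem hasCompactSupport_radialWeight [ProperSpace E] : HasCompactSupport (radialWeight : E → ℝ) :=
  HasCompactSupport.of_support_subset_isCompact (isCompact_closedBall (0 : E) 1) fun x hx => by
    by_contra h
    exact hx (radialWeight_eq_zero (by simpa using (not_le.1 (by simpa using h)).le))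

end SubMeanValue

section SubMeanValue

variable {E : Type*} [NormedAddCommGroup E] [InnerProductSpace ℝ E] [FiniteDimensional ℝ E]

/-- A function of class `C²` near a closed ball agrees on the open ball with a compactly supported
function of class `C²`. -/
theorem exists_contDiff_hasCompactSupport_eqOn {u : E → ℝ} {U : Set E} (hU : IsOpen U)
    (hu : ContDiffOn ℝ 2 u U) {z : E} {r R : ℝ} (hr : 0 < r) (hrR : r < R)
    (hR : closedBall z R ⊆ U) :
    ∃ w : E → ℝ, ContDiff ℝ 2 w ∧ HasCompactSupport w ∧ EqOn w u (ball z r) := by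
  let χ : ContDiffBump z := ⟨r, R, hr, hrR⟩
  refine ⟨fun x => χ x * u x, ?_, χ.hasCompactSupport.mul_right, fun x hx => ?_⟩
  · rw [contDiff_iff_contDiffAt]
    intro x
    by_cases hx : x ∈ closedBall z R
    · exact χ.contDiffAt.mul (hu.contDiffAt (hU.mem_nhds (hR hx)))
    · have : (fun x => χ x * u x) =ᶠ[𝓝 x] fun _ => 0 := by
        filter_upwards [isClosed_closedBall.isOpen_compl.mem_nhds hx] with y hy
        rw [χ.zero_of_le_dist (le_of_lt (by simpa using hy)), zero_mul]
      exact contDiffAt_const.congr_of_eventuallyEq this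
  · simp only
    rw [χ.one_of_mem_closedBall (ball_subset_closedBall hx), one_mul]

variable [MeasurableSpace E] [BorelSpace E]

theorem integrable_mul_radialWeight {k : E → ℝ} (hk : Continuous k) :
    Integrable (fun x => k x * radialWeight x) :=
  (hk.mul continuous_radialWeight).integrable_of_hasCompactSupport
    hasCompactSupport_radialWeight.mul_left

theorem integral_radialWeight_pos : 0 < ∫ x : E, radialWeight x :=
  continuous_radialWeight.integral_pos_of_hasCompactSupport_nonneg_nonzero
    hasCompactSupport_radialWeight radialWeight_nonneg (x := 0) (by simp [radialWeight])

/-- Integration by parts in each basis direction: ρ(x) x is -1/4 times the gradient of ρ², and the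
remaining derivative falls on Du(z + tx), producing the factor t and the trace of D²u. -/
theorem integral_fderiv_mul_radialWeight {u : E → ℝ} (hu : ContDiff ℝ 2 u) (z : E) (t : ℝ) :
    ∫ x, fderiv ℝ u (z + t • x) x * radialWeight x
      = t / 4 * ∫ x, Laplacian.laplacian u (z + t • x) * radialWeight x ^ 2 := by
  set b := stdOrthonormalBasis ℝ E
  have hD : ContDiff ℝ 1 (fderiv ℝ u) := hu.fderiv_right (by norm_num)
  have hDc : Continuous fun x => fderiv ℝ u (z + t • x) :=
    hD.continuous.comp (by fun_prop)
  have hDDc : Continuous fun x => fderiv ℝ (fderiv ℝ u) (z + t • x) :=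
    (hD.continuous_fderiv (by simp)).comp (by fun_prop)
  have hcs : HasCompactSupport fun x : E => radialWeight x ^ 2 := by
    refine (hasCompactSupport_radialWeight (E := E)).comp_left (g := fun s : ℝ => s ^ 2) ?_
    norm_num
  have hcont : Continuous fun x : E => radialWeight x ^ 2 := continuous_radialWeight.pow 2
  have hder : ∀ e x, HasFDerivAt (fun x => fderiv ℝ u (z + t • x) e)
      (t • (ContinuousLinearMap.apply ℝ ℝ e).comp (fderiv ℝ (fderiv ℝ u) (z + t • x))) x := by
    intro e x
    have h1 : HasFDerivAt (fun x : E => z + t • x) (t • ContinuousLinearMap.id ℝ E) x :=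
      ((hasFDerivAt_id x).const_smul t).const_add z
    have h2 := ((hD.differentiable (by simp)) (z + t • x)).hasFDerivAt.comp x h1
    refine (h2.clm_apply (hasFDerivAt_const e x)).congr_fderiv ?_
    ext w
    simp
  have hbasis : ∀ i, ∫ x, fderiv ℝ u (z + t • x) (b i) * (inner ℝ x (b i) * radialWeight x)
      = t / 4 * ∫ x, fderiv ℝ (fderiv ℝ u) (z + t • x) (b i) (b i) * radialWeight x ^ 2 := by
    intro i
    have hg : ∀ x : E, fderiv ℝ (fun y : E => radialWeight y ^ 2) x (b i)
        = -4 * (inner ℝ x (b i) * radialWeight x) := by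
      intro x
      rw [(hasFDerivAt_sq_radialWeight x).fderiv]
      simp
      ring
    have hf : ∀ x, fderiv ℝ (fun x => fderiv ℝ u (z + t • x) (b i)) x (b i)
        = t * fderiv ℝ (fderiv ℝ u) (z + t • x) (b i) (b i) := by
      intro x
      rw [(hder (b i) x).fderiv]
      simp
    have key := integral_mul_fderiv_eq_neg_fderiv_mul_of_integrable (μ := (volume : Measure E))
      (f := fun x => fderiv ℝ u (z + t • x) (b i)) (g := fun y : E => radialWeight y ^ 2)
      (v := b i) ?_ ?_ ?_ (fun x _ => (hder (b i) x).differentiableAt)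
      (fun x _ => (hasFDerivAt_sq_radialWeight x).differentiableAt)
    · simp only [hg, hf] at key
      have e1 : ∀ x : E, fderiv ℝ u (z + t • x) (b i) * (-4 * (inner ℝ x (b i) * radialWeight x))
        = -4 * (fderiv ℝ u (z + t • x) (b i) * (inner ℝ x (b i) * radialWeight x)) :=
        fun x => by ring
      simp only [e1, mul_assoc t, integral_const_mul] at key
      linarith
    · simp only [hf]
      refine Continuous.integrable_of_hasCompactSupport ?_ hcs.mul_left
      exact (continuous_const.mul ((hDDc.clm_apply continuous_const).clm_apply
        continuous_const)).mul hcont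
    · simp only [hg, ← mul_assoc]
      refine integrable_mul_radialWeight ?_
      exact ((hDc.clm_apply continuous_const).mul continuous_const).mul (by fun_prop)
    · refine Continuous.integrable_of_hasCompactSupport ?_ hcs.mul_left
      exact (hDc.clm_apply continuous_const).mul hcont
  have hL : ∀ x, fderiv ℝ u (z + t • x) x * radialWeight x
      = ∑ i, fderiv ℝ u (z + t • x) (b i) * (inner ℝ x (b i) * radialWeight x) := by
    intro x
    conv_lhs => rw [← b.sum_repr' x, map_sum, b.sum_repr' x, Finset.sum_mul]
    refine Finset.sum_congr rfl fun i _ => ?_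
    rw [map_smul, smul_eq_mul, real_inner_comm]
    ring
  simp only [hL, laplacian_eq_sum_fderiv_fderiv b, Finset.sum_mul]
  rw [integral_finsetSum, integral_finsetSum, Finset.mul_sum]
  · exact Finset.sum_congr rfl fun i _ => hbasis i
  · intro i _
    refine Continuous.integrable_of_hasCompactSupport ?_ hcs.mul_left
    exact ((hDDc.clm_apply continuous_const).clm_apply continuous_const).mul hcont
  · intro i _
    simp only [← mul_assoc]
    exact integrable_mul_radialWeight
      ((hDc.clm_apply continuous_const).mul (by fun_prop))

theorem hasDerivAt_integral_radialWeight {u : E → ℝ} (hu : ContDiff ℝ 2 u)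
    (hc : HasCompactSupport u) (z : E) (t : ℝ) :
    HasDerivAt (fun t => ∫ x, u (z + t • x) * radialWeight x)
      (∫ x, fderiv ℝ u (z + t • x) x * radialWeight x) t := by
  have hDc : Continuous (fderiv ℝ u) := hu.continuous_fderiv (by simp)
  -- Compact support bounds Du globally, and the weight vanishes for `1 ≤ ‖x‖`, so the factor x
  -- costs at most 1. Thus `M * radialWeight` dominates for all t.
  obtain ⟨M, hM⟩ := (hc.fderiv (𝕜 := ℝ)).exists_bound_of_continuous hDc
  have hF : ∀ t : ℝ, Integrable fun x => u (z + t • x) * radialWeight x := fun t =>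
    integrable_mul_radialWeight (hu.continuous.comp (by fun_prop))
  refine (hasDerivAt_integral_of_dominated_loc_of_deriv_le (bound := fun x => M * radialWeight x)
    (F' := fun t x => fderiv ℝ u (z + t • x) x * radialWeight x)
    (s := univ) univ_mem (Eventually.of_forall fun t => (hF t).aestronglyMeasurable) (hF t) ?_ ?_
    (integrable_mul_radialWeight continuous_const) ?_).2
  · refine (integrable_mul_radialWeight (k := fun x => fderiv ℝ u (z + t • x) x)
      ?_).aestronglyMeasurable
    exact (hDc.comp (by fun_prop)).clm_apply continuous_id
  · refine Eventually.of_forall fun x s _ => ?_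
    rw [norm_mul, Real.norm_of_nonneg (radialWeight_nonneg x)]
    rcases le_total 1 ‖x‖ with hx | hx
    · simp [radialWeight_eq_zero hx]
    · refine mul_le_mul_of_nonneg_right ?_ (radialWeight_nonneg x)
      refine (ContinuousLinearMap.le_opNorm _ _).trans ?_
      exact (mul_le_of_le_one_right (norm_nonneg _) hx).trans (hM _)
  · refine Eventually.of_forall fun x s _ => ?_
    have h1 : HasDerivAt (fun s : ℝ => z + s • x) x s := by
      simpa using ((hasDerivAt_id s).smul_const x).const_add z
    have h2 := ((hu.differentiable (by simp)) (z + s • x)).hasFDerivAt.comp_hasDerivAt s h1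
    exact h2.mul_const _

/-- The weighted average over radius t has derivative t/4 times an integral of Δu ≥ 0, so it is
monotone; the two sides are its values at t = 0 and t = r. -/
theorem mul_integral_radialWeight_le {u : E → ℝ} (hu : ContDiff ℝ 2 u)
    (hc : HasCompactSupport u) {z : E} {r : ℝ} (hr : 0 < r)
    (hΔ : ∀ y ∈ ball z r, 0 ≤ Laplacian.laplacian u y) :
    u z * ∫ x : E, radialWeight x ≤ ∫ x, u (z + r • x) * radialWeight x := by
  have hmono : MonotoneOn (fun t : ℝ => ∫ x, u (z + t • x) * radialWeight x) (Icc 0 r) := by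
    refine monotoneOn_of_deriv_nonneg (convex_Icc 0 r)
      (fun t _ => (hasDerivAt_integral_radialWeight hu hc z t).continuousAt.continuousWithinAt)
      (fun t _ => (hasDerivAt_integral_radialWeight hu hc z
        t).differentiableAt.differentiableWithinAt) fun t ht => ?_
    rw [interior_Icc] at ht
    rw [(hasDerivAt_integral_radialWeight hu hc z t).deriv, integral_fderiv_mul_radialWeight hu]
    refine mul_nonneg (by linarith [ht.1]) (integral_nonneg fun x => ?_)
    rcases le_total 1 ‖x‖ with hx | hx
    · simp [radialWeight_eq_zero hx]
    · refine mul_nonneg (hΔ _ ?_) (sq_nonneg _)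
      rw [mem_ball, dist_eq_norm, add_sub_cancel_left, norm_smul, Real.norm_of_nonneg ht.1.le]
      nlinarith [ht.1, ht.2, norm_nonneg x]
  have := hmono (left_mem_Icc.2 hr.le) (right_mem_Icc.2 hr.le) hr.le
  simpa [integral_const_mul] using this

/-- Sub-mean value inequality for nonnegative `C²` functions with nonnegative Laplacian, up to a
dimensional constant. -/
theorem mul_integral_radialWeight_le_setIntegral {u : E → ℝ} {U : Set E} (hU : IsOpen U)
    (hu : ContDiffOn ℝ 2 u U) {z : E} {r R : ℝ} (hr : 0 < r) (hrR : r < R)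
    (hR : closedBall z R ⊆ U) (h0 : ∀ y ∈ ball z r, 0 ≤ u y)
    (hΔ : ∀ y ∈ ball z r, 0 ≤ Laplacian.laplacian u y) :
    r ^ Module.finrank ℝ E * (u z * ∫ x : E, radialWeight x) ≤ ∫ y in ball z r, u y := by
  obtain ⟨w, hw, hwc, hwu⟩ := exists_contDiff_hasCompactSupport_eqOn hU hu hr hrR hR
  have hΔw : ∀ y ∈ ball z r, 0 ≤ Laplacian.laplacian w y := by
    intro y hy
    have : w =ᶠ[𝓝 y] u := hwu.eventuallyEq_of_mem (isOpen_ball.mem_nhds hy)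
    rw [(InnerProductSpace.laplacian_congr_nhds this).self_of_nhds]
    exact hΔ y hy
  have h1 := mul_integral_radialWeight_le hw hwc hr hΔw
  rw [hwu (mem_ball_self hr)] at h1
  have hrN : 0 < r ^ Module.finrank ℝ E := pow_pos hr _
  -- Substitution y = z + r x, with Jacobian r^N.
  have h2 : r ^ Module.finrank ℝ E * ∫ x, w (z + r • x) * radialWeight x
      = ∫ y, w y * radialWeight (r⁻¹ • (y - z)) := by
    have e1 := integral_add_left_eq_self (μ := (volume : Measure E))
      (fun y => w y * radialWeight (r⁻¹ • (y - z))) z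
    have e2 := Measure.integral_comp_smul (volume : Measure E)
      (fun y => w (z + y) * radialWeight (r⁻¹ • (z + y - z))) r
    simp only [add_sub_cancel_left, inv_smul_smul₀ hr.ne'] at e1 e2
    rw [e2, ← e1, smul_eq_mul, abs_of_pos (inv_pos.2 hrN), mul_inv_cancel_left₀ hrN.ne']
  refine (mul_le_mul_of_nonneg_left h1 hrN.le).trans (h2.le.trans ?_)
  rw [← integral_indicator measurableSet_ball]
  have hint : IntegrableOn w (ball z r) :=
    (hw.continuous.integrable_of_hasCompactSupport hwc).integrableOn
  refine integral_mono_of_nonneg (Eventually.of_forall fun y => ?_)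
    ((integrable_indicator_iff measurableSet_ball).2
      (hint.congr_fun hwu measurableSet_ball)) (Eventually.of_forall fun y => ?_)
  all_goals
    by_cases hy : y ∈ ball z r
    · have := h0 y hy
      rw [← hwu hy] at this
      first
        | exact mul_nonneg this (radialWeight_nonneg _)
        | simp only [indicator_of_mem hy]
          rw [← hwu hy]
          exact mul_le_of_le_one_right this (radialWeight_le_one _)
    · have : radialWeight (r⁻¹ • (y - z)) = 0 := by
        refine radialWeight_eq_zero ?_
        rw [norm_smul, norm_inv, Real.norm_of_nonneg hr.le, ← dist_eq_norm, ← div_eq_inv_mul,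
          one_le_div hr]
        simpa using hy
      simp [this, hy]

end SubMeanValue

/-! ### Powers of the norm and the Laplacian of `‖f‖ ^ p` -/

section NormPow

variable {F : Type*} [NormedAddCommGroup F] [InnerProductSpace ℝ F]

/-- The derivative of `w ↦ ‖w‖ ^ s • w`. -/
noncomputable def rpowNormSmulDeriv (s : ℝ) (w : F) : F →L[ℝ] F :=
  ‖w‖ ^ s • ContinuousLinearMap.id ℝ F + (s * ‖w‖ ^ (s - 2)) • (innerSL ℝ w).smulRight w

/-- Up to the factor p, this map with s = p - 2 is the gradient of `‖w‖ ^ p`, so its regularity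
gives C² regularity for every p ≥ 2. At the origin with s > 0 the map is o(‖w‖), so its derivative
there is 0; s = 0 is the identity. -/
theorem hasFDerivAt_rpow_norm_smul {s : ℝ} (hs : 0 ≤ s) (w : F) :
    HasFDerivAt (fun w : F => ‖w‖ ^ s • w) (rpowNormSmulDeriv s w) w := by
  rcases hs.eq_or_lt with rfl | hs
  · have h := hasFDerivAt_id (𝕜 := ℝ) w
    simp only [rpowNormSmulDeriv, Real.rpow_zero, one_smul, zero_mul, zero_smul, add_zero]
    exact h
  by_cases hw : w = 0
  · subst hw
    have h0 : rpowNormSmulDeriv s (0 : F) = 0 := by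
      simp [rpowNormSmulDeriv, Real.zero_rpow hs.ne']
    rw [h0]
    refine .of_isLittleO ?_
    have h1 : (fun w : F => ‖w‖ ^ s) =o[𝓝 0] fun _ => (1 : ℝ) := by
      refine (Asymptotics.isLittleO_const_iff one_ne_zero).2 ?_
      have := (continuous_norm (E := F)).continuousAt (x := 0) |>.rpow_const (p := s) (.inr hs.le)
      simpa [ContinuousAt, Real.zero_rpow hs.ne'] using this
    simpa using h1.smul_isBigO (Asymptotics.isBigO_refl (fun w : F => w) (𝓝 0))
  · have h1 : HasFDerivAt (fun w : F => ‖w‖ ^ s) ((s * ‖w‖ ^ (s - 2)) • innerSL ℝ w) w := by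
      apply HasStrictFDerivAt.hasFDerivAt
      convert! (hasStrictFDerivAt_norm_sq w).rpow_const (p := s / 2) (by simp [hw]) using 0
      simp_rw [← Real.rpow_natCast_mul (norm_nonneg _), ← Nat.cast_smul_eq_nsmul ℝ, smul_smul]
      ring_nf
    refine (h1.smul (hasFDerivAt_id w)).congr_fderiv ?_
    ext v
    simp [rpowNormSmulDeriv, smul_smul]

/-- Only an inequality: at a = 0, s = 0 the left side is 0 and the right side is 1. -/
theorem rpow_sub_two_mul_sq_le {a s : ℝ} (ha : 0 ≤ a) : a ^ (s - 2) * a ^ 2 ≤ a ^ s := by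
  rcases ha.eq_or_lt with rfl | ha
  · simpa using Real.rpow_nonneg le_rfl s
  · rw [← Real.rpow_natCast a 2, ← Real.rpow_add ha]
    simp

/-- Convexity of the norm power: up to the factor p, this is its Hessian form. -/
theorem inner_rpowNormSmulDeriv_nonneg {s : ℝ} (hs : 0 ≤ s) (w v : F) :
    0 ≤ inner ℝ (rpowNormSmulDeriv s w v) v := by
  have h1 : inner ℝ (rpowNormSmulDeriv s w v) v
      = ‖w‖ ^ s * ‖v‖ ^ 2 + s * ‖w‖ ^ (s - 2) * (inner ℝ w v) ^ 2 := by
    simp only [rpowNormSmulDeriv, add_apply, smul_apply,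
      ContinuousLinearMap.id_apply, ContinuousLinearMap.smulRight_apply, innerSL_apply_apply,
      inner_add_left, real_inner_smul_left, real_inner_self_eq_norm_sq]
    ring
  rw [h1]
  positivity

theorem norm_rpowNormSmulDeriv_le {s : ℝ} (hs : 0 ≤ s) (w : F) :
    ‖rpowNormSmulDeriv s w‖ ≤ (1 + s) * ‖w‖ ^ s := by
  refine (norm_add_le _ _).trans ?_
  rw [norm_smul, norm_smul, ContinuousLinearMap.norm_smulRight_apply, innerSL_apply_norm,
    Real.norm_of_nonneg (by positivity), Real.norm_of_nonneg (by positivity)]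
  have h1 := rpow_sub_two_mul_sq_le (s := s) (norm_nonneg w)
  have h2 : ‖w‖ ^ s * ‖ContinuousLinearMap.id ℝ F‖ ≤ ‖w‖ ^ s :=
    mul_le_of_le_one_right (by positivity) ContinuousLinearMap.norm_id_le
  nlinarith [mul_le_mul_of_nonneg_left h1 hs]

theorem continuous_rpowNormSmulDeriv {s : ℝ} (hs : 0 ≤ s) :
    Continuous (rpowNormSmulDeriv s : F → F →L[ℝ] F) := by
  rcases hs.eq_or_lt with rfl | hs
  · have : (rpowNormSmulDeriv 0 : F → F →L[ℝ] F) = fun _ => ContinuousLinearMap.id ℝ F := by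
      ext; simp [rpowNormSmulDeriv]
    rw [this]
    exact continuous_const
  refine continuous_iff_continuousAt.2 fun w => ?_
  by_cases hw : w = 0
  · subst hw
    have h0 : rpowNormSmulDeriv s (0 : F) = 0 := by
      simp [rpowNormSmulDeriv, Real.zero_rpow hs.ne']
    rw [ContinuousAt, h0]
    refine squeeze_zero_norm (norm_rpowNormSmulDeriv_le hs.le) ?_
    have := (continuous_norm (E := F)).continuousAt (x := 0) |>.rpow_const (p := s) (.inr hs.le)
    simpa [ContinuousAt, Real.zero_rpow hs.ne'] using this.const_mul (1 + s)
  · have hn : ContinuousAt (fun w : F => ‖w‖) w := continuous_norm.continuousAt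
    have hw' : ‖w‖ ≠ 0 := norm_ne_zero_iff.2 hw
    refine ((hn.rpow_const (.inl hw')).smul continuousAt_const).add
      ((continuousAt_const.mul (hn.rpow_const (.inl hw'))).smul ?_)
    have : Continuous fun w : F => (innerSL ℝ w).smulRight w :=
      (ContinuousLinearMap.smulRightL ℝ F F).continuous₂.comp
        ((innerSL ℝ).continuous.prodMk continuous_id)
    exact this.continuousAt

theorem fderiv_norm_rpow_eq {p : ℝ} (hp : 2 ≤ p) :
    fderiv ℝ (fun w : F => ‖w‖ ^ p) = fun w => p • innerSL ℝ (‖w‖ ^ (p - 2) • w) := by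
  ext w v
  rw [fderiv_norm_rpow w (by linarith)]
  simp [mul_assoc]

theorem hasFDerivAt_fderiv_norm_rpow {p : ℝ} (hp : 2 ≤ p) (w : F) :
    HasFDerivAt (fderiv ℝ (fun w : F => ‖w‖ ^ p))
      (p • (innerSL ℝ).comp (rpowNormSmulDeriv (p - 2) w)) w := by
  rw [fderiv_norm_rpow_eq hp]
  exact ((innerSL ℝ).hasFDerivAt.comp w
    (hasFDerivAt_rpow_norm_smul (by linarith : 0 ≤ p - 2) w)).const_smul p

theorem contDiff_two_norm_rpow {p : ℝ} (hp : 2 ≤ p) : ContDiff ℝ 2 fun w : F => ‖w‖ ^ p := by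
  rw [show (2 : WithTop ℕ∞) = 1 + 1 by norm_num, contDiff_succ_iff_fderiv]
  refine ⟨differentiable_norm_rpow (by linarith), by simp, ?_⟩
  rw [contDiff_one_iff_fderiv]
  refine ⟨fun w => (hasFDerivAt_fderiv_norm_rpow hp w).differentiableAt, ?_⟩
  rw [show fderiv ℝ (fderiv ℝ fun w : F => ‖w‖ ^ p) = _ from
    funext fun w => (hasFDerivAt_fderiv_norm_rpow hp w).fderiv]
  exact ((continuous_rpowNormSmulDeriv (by linarith)).const_clm_comp _).const_smul p

variable {E : Type*} [NormedAddCommGroup E] [InnerProductSpace ℝ E] [FiniteDimensional ℝ E]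

theorem laplacian_norm_rpow {p : ℝ} (hp : 2 ≤ p) {f : E → F} {x : E} (hf : ContDiffAt ℝ 2 f x)
    {ι : Type*} [Fintype ι] (b : OrthonormalBasis ι ℝ E) :
    Laplacian.laplacian (fun y => ‖f y‖ ^ p) x
      = p * ∑ i, inner ℝ (rpowNormSmulDeriv (p - 2) (f x) (fderiv ℝ f x (b i)))
          (fderiv ℝ f x (b i))
        + p * ‖f x‖ ^ (p - 2) * inner ℝ (f x) (Laplacian.laplacian f x) := by
  rw [laplacian_eq_sum_fderiv_fderiv b, laplacian_eq_sum_fderiv_fderiv b, inner_sum,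
    Finset.mul_sum, Finset.mul_sum, ← Finset.sum_add_distrib]
  refine Finset.sum_congr rfl fun i _ => ?_
  rw [fderiv_fderiv_comp_apply (Φ := fun w : F => ‖w‖ ^ p) hf
    (contDiff_two_norm_rpow hp).contDiffAt, (hasFDerivAt_fderiv_norm_rpow hp _).fderiv,
    fderiv_norm_rpow_eq hp]
  simp [mul_assoc]

theorem laplacian_norm_rpow_nonneg {p : ℝ} (hp : 2 ≤ p) {f : E → F} {x : E}
    (hf : ContDiffAt ℝ 2 f x) (h : 0 ≤ inner ℝ (f x) (Laplacian.laplacian f x)) :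
    0 ≤ Laplacian.laplacian (fun y => ‖f y‖ ^ p) x := by
  rw [laplacian_norm_rpow hp hf (stdOrthonormalBasis ℝ E)]
  have hs := Finset.sum_nonneg fun i (_ : i ∈ Finset.univ) =>
    inner_rpowNormSmulDeriv_nonneg (by linarith : 0 ≤ p - 2) (f x)
      (fderiv ℝ f x (stdOrthonormalBasis ℝ E i))
  positivity

theorem abs_laplacian_norm_rpow_le {p : ℝ} (hp : 2 ≤ p) {f : E → F} {x : E}
    (hf : ContDiffAt ℝ 2 f x) {A K : ℝ} (hA : ‖Laplacian.laplacian f x‖ ≤ A * ‖f x‖)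
    (hK : ∀ v, ‖fderiv ℝ f x v‖ ^ 2 ≤ K * ‖v‖ ^ 2) :
    |Laplacian.laplacian (fun y => ‖f y‖ ^ p) x|
      ≤ p * (p - 1) * Module.finrank ℝ E * (‖f x‖ ^ (p - 2) * K) + p * A * ‖f x‖ ^ p := by
  set b := stdOrthonormalBasis ℝ E
  rw [laplacian_norm_rpow hp hf b]
  -- The Hessian bound 1 + (p - 2) = p - 1 applies in each basis direction; summing yields the
  -- factor `Module.finrank ℝ E`.
  have hterm : ∀ i, |inner ℝ (rpowNormSmulDeriv (p - 2) (f x) (fderiv ℝ f x (b i)))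
      (fderiv ℝ f x (b i))| ≤ (p - 1) * (‖f x‖ ^ (p - 2) * K) := by
    intro i
    refine (abs_real_inner_le_norm _ _).trans ?_
    have h1 := (rpowNormSmulDeriv (p - 2) (f x)).le_opNorm (fderiv ℝ f x (b i))
    have h2 := norm_rpowNormSmulDeriv_le (by linarith : 0 ≤ p - 2) (f x)
    have h3 : ‖fderiv ℝ f x (b i)‖ ^ 2 ≤ K := by simpa using hK (b i)
    calc _ ≤ ((1 + (p - 2)) * ‖f x‖ ^ (p - 2)) * ‖fderiv ℝ f x (b i)‖ * ‖fderiv ℝ f x (b i)‖ := by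
          gcongr
          exact h1.trans (by gcongr)
      _ = (p - 1) * (‖f x‖ ^ (p - 2) * ‖fderiv ℝ f x (b i)‖ ^ 2) := by ring
      _ ≤ _ := by
          have : 0 ≤ p - 1 := by linarith
          gcongr
  refine (abs_add_le _ _).trans (add_le_add ?_ ?_)
  · rw [abs_mul, abs_of_nonneg (by linarith : 0 ≤ p)]
    have h4 := (Finset.abs_sum_le_sum_abs _ _).trans (Finset.sum_le_sum fun i
      (_ : i ∈ Finset.univ) => hterm i)
    rw [Finset.sum_const, Finset.card_univ, Fintype.card_fin, nsmul_eq_mul] at h4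
    calc _ ≤ p * (Module.finrank ℝ E * ((p - 1) * (‖f x‖ ^ (p - 2) * K))) := by gcongr
      _ = _ := by ring
  · have hp0 : 0 ≤ p := by linarith
    rw [abs_mul, abs_of_nonneg (by positivity)]
    have h5 := (abs_real_inner_le_norm (f x) (Laplacian.laplacian f x)).trans
      (mul_le_mul_of_nonneg_left hA (norm_nonneg _))
    have h6 : ‖f x‖ ^ (p - 2) * ‖f x‖ ^ 2 = ‖f x‖ ^ p := by
      rw [← Real.rpow_natCast, ← Real.rpow_add_of_nonneg (norm_nonneg _) (by linarith) (by simp)]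
      simp
    calc _ ≤ p * ‖f x‖ ^ (p - 2) * (‖f x‖ * (A * ‖f x‖)) := by gcongr
      _ = p * A * (‖f x‖ ^ (p - 2) * ‖f x‖ ^ 2) := by ring
      _ = _ := by rw [h6]

end NormPow

/-! ### The ball, the gradient norm and the Dirichlet-type space -/

namespace YukawaBall

variable {n : ℕ}

theorem isOpen_unitBall : IsOpen (unitBall n) := isOpen_ball

theorem mem_unitBall {z : Cn n} : z ∈ unitBall n ↔ ‖z‖ < 1 := by simp [unitBall]

theorem finrank_real_Cn (n : ℕ) : Module.finrank ℝ (Cn n) = 2 * n := by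
  have := finrank_real_of_complex (Cn n)
  rwa [finrank_euclideanSpace_fin] at this

/-- The nearest boundary point is z/‖z‖, or any unit vector when z = 0. This needs n ≥ 1, as
otherwise the sphere is empty. -/
theorem distBdry_eq (hn : 1 ≤ n) {z : Cn n} (hz : z ∈ unitBall n) : distBdry z = 1 - ‖z‖ := by
  have : Nonempty (Fin n) := ⟨⟨0, hn⟩⟩
  rw [distBdry, unitBall, frontier_ball _ one_ne_zero]
  rw [mem_unitBall] at hz
  obtain ⟨e, he, hze⟩ : ∃ e : Cn n, ‖e‖ = 1 ∧ z = ‖z‖ • e := by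
    by_cases h : z = 0
    · obtain ⟨e, he⟩ := exists_norm_eq (Cn n) zero_le_one
      exact ⟨e, he, by simp [h]⟩
    · have h' : ‖z‖ ≠ 0 := norm_ne_zero_iff.2 h
      exact ⟨‖z‖⁻¹ • z, by rw [norm_smul, norm_inv, norm_norm, inv_mul_cancel₀ h'],
        by rw [smul_inv_smul₀ h']⟩
  have hes : e ∈ sphere (0 : Cn n) 1 := by simpa using he
  refine le_antisymm ((infDist_le_dist_of_mem hes).trans ?_) ?_
  · have : z - e = (‖z‖ - 1) • e := by
      conv_lhs => rw [hze]
      rw [sub_smul, one_smul]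
    rw [dist_eq_norm, this, norm_smul, he, mul_one, Real.norm_eq_abs, abs_sub_comm,
      abs_of_nonneg (by linarith)]
  · refine (le_infDist ⟨e, hes⟩).2 fun y hy => ?_
    have hy' : ‖y‖ = 1 := by simpa using hy
    rw [dist_comm, dist_eq_norm, ← hy']
    exact norm_sub_norm_le y z

theorem normD_nonneg (f : Cn n → ℂ) (z : Cn n) : 0 ≤ normD f z := Real.sqrt_nonneg _

/-- The parallelogram law applied to ∂ₓf and i ∂ᵧf. -/
theorem norm_wirtinger_sq_add (f : Cn n → ℂ) (k : Fin n) (z : Cn n) :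
    ‖wirtinger f k z‖ ^ 2 + ‖wirtingerBar f k z‖ ^ 2
      = (‖partialX f k z‖ ^ 2 + ‖partialY f k z‖ ^ 2) / 2 := by
  simp only [wirtinger, wirtingerBar, ← Complex.normSq_eq_norm_sq, Complex.normSq_apply]
  simp
  ring

theorem normD_sq (f : Cn n → ℂ) (z : Cn n) :
    2 * normD f z ^ 2 = ∑ k, (‖partialX f k z‖ ^ 2 + ‖partialY f k z‖ ^ 2) := by
  rw [normD, Real.sq_sqrt (by positivity), ← Finset.sum_add_distrib, Finset.mul_sum]
  refine Finset.sum_congr rfl fun k _ => ?_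
  rw [norm_wirtinger_sq_add]
  ring

/-- Cauchy–Schwarz twice: in the real and imaginary parts of each coordinate, then over the
coordinates. -/
theorem norm_fderiv_apply_sq_le (f : Cn n → ℂ) (z v : Cn n) :
    ‖fderiv ℝ f z v‖ ^ 2 ≤ 2 * normD f z ^ 2 * ‖v‖ ^ 2 := by
  have hv : v = ∑ k, ((v k).re • EuclideanSpace.single k (1 : ℂ)
      + (v k).im • EuclideanSpace.single k Complex.I) := by
    ext j
    simp [Finset.sum_add_distrib, Pi.single_apply]
  have h1 : ‖fderiv ℝ f z v‖
      ≤ ∑ k, ‖v k‖ * √(‖partialX f k z‖ ^ 2 + ‖partialY f k z‖ ^ 2) := by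
    conv_lhs => rw [hv, map_sum]
    refine (norm_sum_le _ _).trans (Finset.sum_le_sum fun k _ => ?_)
    rw [map_add, map_smul, map_smul]
    refine (norm_add_le _ _).trans ?_
    rw [norm_smul, norm_smul]
    refine (abs_le_of_sq_le_sq' ?_ (by positivity)).2
    rw [mul_pow, Real.sq_sqrt (by positivity), ← Complex.normSq_eq_norm_sq, Complex.normSq_apply]
    change (‖(v k).re‖ * ‖partialX f k z‖ + ‖(v k).im‖ * ‖partialY f k z‖) ^ 2 ≤ _
    rw [← abs_mul_abs_self (v k).re, ← abs_mul_abs_self (v k).im, Real.norm_eq_abs,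
      Real.norm_eq_abs]
    nlinarith [sq_nonneg (|(v k).re| * ‖partialY f k z‖ - |(v k).im| * ‖partialX f k z‖)]
  calc ‖fderiv ℝ f z v‖ ^ 2
      ≤ (∑ k, ‖v k‖ * √(‖partialX f k z‖ ^ 2 + ‖partialY f k z‖ ^ 2)) ^ 2 := by gcongr
    _ ≤ (∑ k, ‖v k‖ ^ 2) * ∑ k, √(‖partialX f k z‖ ^ 2 + ‖partialY f k z‖ ^ 2) ^ 2 :=
        Finset.sum_mul_sq_le_sq_mul_sq _ _ _
    _ = _ := by
        rw [normD_sq, EuclideanSpace.norm_sq_eq, mul_comm]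
        congr 1
        exact Finset.sum_congr rfl fun k _ => Real.sq_sqrt (by positivity)

theorem continuousOn_normD {f : Cn n → ℂ} (hf : ContDiffOn ℝ 1 f (unitBall n)) :
    ContinuousOn (normD f) (unitBall n) := by
  have h := hf.continuousOn_fderiv_of_isOpen isOpen_unitBall le_rfl
  have hX : ∀ k, ContinuousOn (partialX f k) (unitBall n) := fun k =>
    h.clm_apply continuousOn_const
  have hY : ∀ k, ContinuousOn (partialY f k) (unitBall n) := fun k =>
    h.clm_apply continuousOn_const
  unfold normD wirtinger wirtingerBar
  fun_prop

theorem volume_unitBall_pos : 0 < volume (unitBall n) := measure_ball_pos _ _ one_pos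

theorem volume_unitBall_lt_top : volume (unitBall n) < ⊤ := measure_ball_lt_top

theorem integrable_normVol_iff {F : Type*} [NormedAddCommGroup F] {g : Cn n → F} :
    Integrable g (normVol n) ↔ IntegrableOn g (unitBall n) :=
  integrable_smul_measure (ENNReal.inv_ne_zero.2 volume_unitBall_lt_top.ne)
    (ENNReal.inv_ne_top.2 volume_unitBall_pos.ne')

/-- Membership in the Dirichlet-type space as integrability of the weighted gradient. -/
theorem integrableOn_of_memDirichlet (hn : 1 ≤ n) {γ α : ℝ} (hγ : 0 ≤ γ) (hα : 0 < α)
    {f : Cn n → ℂ} (hf : MemDirichlet γ α f) :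
    IntegrableOn (fun z => (1 - ‖z‖) ^ γ * normD f z ^ α) (unitBall n) := by
  obtain ⟨hf1, hfin⟩ := hf
  have hE : energy f γ 0 α < ⊤ := by
    have h1 : energy f γ 0 α ^ (1 / α) < ⊤ := lt_of_le_of_lt le_add_self hfin
    by_contra h
    rw [not_lt, top_le_iff] at h
    rw [h, ENNReal.top_rpow_of_pos (by positivity)] at h1
    exact lt_irrefl _ h1
  rw [energy, normVol, lintegral_smul_measure, smul_eq_mul] at hE
  -- The normalizing factor is nonzero, so finiteness passes to the unnormalized integral.
  replace hE := (ENNReal.mul_lt_top_iff.1 hE).imp And.right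
    (Or.resolve_left · (ENNReal.inv_ne_zero.2 volume_unitBall_lt_top.ne))
  replace hE := hE.elim id fun h => h.trans_lt ENNReal.zero_lt_top
  have hmeas : AEStronglyMeasurable (fun z => (1 - ‖z‖) ^ γ * normD f z ^ α)
      (volume.restrict (unitBall n)) := by
    refine ContinuousOn.aestronglyMeasurable ?_ isOpen_unitBall.measurableSet
    refine ContinuousOn.mul ?_ ((continuousOn_normD hf1).rpow_const fun _ _ => .inr hα.le)
    exact (continuousOn_const.sub continuous_norm.continuousOn).rpow_const fun _ _ => .inr hγ
  refine ⟨hmeas, ?_⟩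
  rw [hasFiniteIntegral_iff_norm]
  refine lt_of_le_of_lt (lintegral_mono_ae ?_) hE
  filter_upwards [ae_restrict_mem isOpen_unitBall.measurableSet] with z hz
  have hz1 : 0 ≤ 1 - ‖z‖ := by linarith [mem_unitBall.1 hz]
  have hD := normD_nonneg f z
  rw [distBdry_eq hn hz, Real.norm_of_nonneg (by positivity), ENNReal.ofReal_mul (by positivity),
    ENNReal.ofReal_rpow_of_nonneg hz1 hγ, ENNReal.ofReal_rpow_of_nonneg hD hα.le,
    ENNReal.rpow_zero, mul_one]

end YukawaBall

/-! ### Growth of the gradient and of the solution -/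

namespace YukawaBall

variable {n : ℕ}

/-- Plays the role of Hölder's inequality in passing from exponent α to exponent 2. -/
theorem sq_le_one_add_rpow {x α : ℝ} (hx : 0 ≤ x) (hα : 2 ≤ α) : x ^ 2 ≤ 1 + x ^ α := by
  rcases le_total x 1 with h | h
  · have := Real.rpow_nonneg hx α
    nlinarith
  · have := Real.rpow_le_rpow_of_exponent_le h hα
    rw [Real.rpow_two] at this
    linarith

/-- Every directional derivative `h` of a solution has `⟨h, Δh⟩ ≥ 0`. -/
theorem inner_fderiv_laplacian_nonneg {f : Cn n → ℂ} {τ η : ℝ} (hτ : 0 ≤ τ) (hη : 0 ≤ η)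
    (hf : ContDiffOn ℝ 3 f (unitBall n)) (hY : SolvesYukawa (fun _ => τ) (fun _ => η) f)
    {z : Cn n} (hz : z ∈ unitBall n) (v : Cn n) :
    0 ≤ inner ℝ (fderiv ℝ f z v) (Laplacian.laplacian (fun y => fderiv ℝ f y v) z) := by
  have hfz : ContDiffAt ℝ 3 f z := hf.contDiffAt (isOpen_unitBall.mem_nhds hz)
  have hd : HasFDerivAt f (fderiv ℝ f z) z := (hfz.differentiableAt (by simp)).hasFDerivAt
  have hlap : Laplacian.laplacian f =ᶠ[𝓝 z]
      fun z => (τ : ℂ) * f z + (η : ℂ) * ((f z).re : ℂ) := by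
    filter_upwards [isOpen_unitBall.mem_nhds hz] with y hy using hY.2 y hy
  have hre : HasFDerivAt (fun y => ((f y).re : ℂ))
      ((Complex.ofRealCLM.comp Complex.reCLM).comp (fderiv ℝ f z)) z :=
    (Complex.ofRealCLM.comp Complex.reCLM).hasFDerivAt.comp z hd
  have h1 := (hd.const_mul (τ : ℂ)).add (hre.const_mul (η : ℂ))
  rw [laplacian_fderiv_apply hfz, hlap.fderiv_eq]
  erw [h1.fderiv]
  simp [Complex.inner]
  nlinarith [mul_nonneg hτ (sq_nonneg (fderiv ℝ f z v).re),
    mul_nonneg hτ (sq_nonneg (fderiv ℝ f z v).im), mul_nonneg hη (sq_nonneg (fderiv ℝ f z v).re)]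

/-- Pointwise bound of the gradient by the weighted energy density, with `δ = d ^ (-(2n+γ)/α)`. -/
theorem norm_fderiv_apply_sq_le_of_le {γ α d : ℝ} (hγ : 0 ≤ γ) (hα : 2 ≤ α) (hd0 : 0 < d)
    {y : Cn n} (hy1 : d / 2 ≤ 1 - ‖y‖) (f : Cn n → ℂ) (v : Cn n) :
    ‖fderiv ℝ f y v‖ ^ 2 ≤ 2 * (d ^ (-((2 * n + γ) / α))) ^ 2 * ‖v‖ ^ 2 *
      (1 + d ^ (2 * n) * 2 ^ γ * ((1 - ‖y‖) ^ γ * normD f y ^ α)) := by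
  set δ := d ^ (-((2 * n + γ) / α)) with hδ
  have hδ0 : 0 < δ := Real.rpow_pos_of_pos hd0 _
  have hα0 : 0 < α := by linarith
  have hD := normD_nonneg f y
  -- This normalization fixes δ: the factor d^{2n} will match the volume of a ball of radius
  -- comparable to d, and d^γ the weight, which on `d / 2 ≤ 1 - ‖y‖` loses at most 2^γ.
  have hδα : δ ^ α * d ^ (2 * n + γ) = 1 := by
    rw [hδ, ← Real.rpow_mul hd0.le, ← Real.rpow_add hd0]
    field_simp
    simp
  have h1 : (normD f y / δ) ^ 2 ≤ 1 + (normD f y / δ) ^ α :=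
    sq_le_one_add_rpow (by positivity) hα
  have h2 : (normD f y / δ) ^ α ≤ d ^ (2 * n) * 2 ^ γ * ((1 - ‖y‖) ^ γ * normD f y ^ α) := by
    have h3 : d ^ γ ≤ 2 ^ γ * (1 - ‖y‖) ^ γ := by
      rw [← Real.mul_rpow (by norm_num) (by linarith)]
      exact Real.rpow_le_rpow hd0.le (by linarith) hγ
    have h4 : d ^ (2 * (n : ℝ) + γ) = d ^ (2 * n) * d ^ γ := by
      rw [Real.rpow_add hd0, ← Real.rpow_natCast]
      push_cast
      rfl
    have h5 : (normD f y / δ) ^ α = normD f y ^ α * (d ^ (2 * n) * d ^ γ) := by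
      rw [Real.div_rpow hD hδ0.le, ← h4, div_eq_iff (by positivity), mul_assoc,
        mul_comm (d ^ _), hδα, mul_one]
    rw [h5]
    calc normD f y ^ α * (d ^ (2 * n) * d ^ γ)
        ≤ normD f y ^ α * (d ^ (2 * n) * (2 ^ γ * (1 - ‖y‖) ^ γ)) := by gcongr
      _ = _ := by ring
  rw [div_pow, div_le_iff₀ (by positivity)] at h1
  refine (norm_fderiv_apply_sq_le f y v).trans ?_
  have h6 : normD f y ^ 2
      ≤ (1 + d ^ (2 * n) * 2 ^ γ * ((1 - ‖y‖) ^ γ * normD f y ^ α)) * δ ^ 2 :=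
    h1.trans (by gcongr)
  calc 2 * normD f y ^ 2 * ‖v‖ ^ 2 ≤ 2 * ((1 + d ^ (2 * n) * 2 ^ γ *
        ((1 - ‖y‖) ^ γ * normD f y ^ α)) * δ ^ 2) * ‖v‖ ^ 2 := by gcongr
    _ = _ := by ring

/-- Growth of the gradient: `|Df(z) v| ≤ C (1 - |z|)^{-(2n+γ)/α} |v|`. -/
theorem exists_norm_fderiv_apply_le {f : Cn n → ℂ} {γ α : ℝ} (hγ : 0 ≤ γ) (hα : 2 ≤ α)
    (hf : ContDiffOn ℝ 3 f (unitBall n))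
    (hsub : ∀ z ∈ unitBall n, ∀ v,
      0 ≤ inner ℝ (fderiv ℝ f z v) (Laplacian.laplacian (fun y => fderiv ℝ f y v) z))
    (hint : IntegrableOn (fun z => (1 - ‖z‖) ^ γ * normD f z ^ α) (unitBall n)) :
    ∃ C, 0 ≤ C ∧ ∀ z ∈ unitBall n, ∀ v,
      ‖fderiv ℝ f z v‖ ≤ C * (1 - ‖z‖) ^ (-((2 * n + γ) / α)) * ‖v‖ := by
  set κ := ∫ x : Cn n, radialWeight x
  have hκ : 0 < κ := integral_radialWeight_pos
  set J := ∫ z in unitBall n, (1 - ‖z‖) ^ γ * normD f z ^ α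
  have hpos : ∀ z ∈ unitBall n, 0 ≤ (1 - ‖z‖) ^ γ * normD f z ^ α := fun z hz => by
    have : 0 ≤ 1 - ‖z‖ := by linarith [mem_unitBall.1 hz]
    have := normD_nonneg f z
    positivity
  have hJ : 0 ≤ J := setIntegral_nonneg isOpen_unitBall.measurableSet hpos
  set ω := volume.real (ball (0 : Cn n) 1)
  have hω : 0 ≤ ω := measureReal_nonneg
  -- The term ω comes from integrating 1 over the ball, 2^{2n} from replacing d^{2n} by (d/2)^{2n},
  -- 2^γ from comparing weights; κ is the mass of the radial weight.
  set K := 2 * (ω + 2 ^ (2 * n) * 2 ^ γ * J) / κ with hK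
  have hK0 : 0 ≤ K := by positivity
  refine ⟨√K, Real.sqrt_nonneg _, fun z hz v => ?_⟩
  have hz1 := mem_unitBall.1 hz
  set d := 1 - ‖z‖ with hd
  have hd0 : 0 < d := by linarith
  set δ := d ^ (-((2 * n + γ) / α)) with hδ
  have hδ0 : 0 < δ := Real.rpow_pos_of_pos hd0 _
  -- Any radius strictly between d/2 and d would do: the sub-mean value inequality needs room around
  -- the ball of radius d/2.
  have hball : closedBall z (3 * d / 4) ⊆ unitBall n := by
    intro w hw
    rw [mem_closedBall, dist_eq_norm] at hw
    rw [mem_unitBall]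
    have := norm_le_norm_add_norm_sub z w
    rw [norm_sub_rev] at this
    linarith
  have hh : ContDiffOn ℝ 2 (fun y => fderiv ℝ f y v) (unitBall n) :=
    (hf.fderiv_of_isOpen isOpen_unitBall (by norm_num)).clm_apply contDiffOn_const
  have hu : ContDiffOn ℝ 2 (fun y => ‖fderiv ℝ f y v‖ ^ (2 : ℝ)) (unitBall n) :=
    (contDiff_two_norm_rpow le_rfl).comp_contDiffOn hh
  have hsubset : ball z (d / 2) ⊆ unitBall n :=
    (ball_subset_closedBall.trans (closedBall_subset_closedBall (by linarith))).trans hball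
  have key := mul_integral_radialWeight_le_setIntegral isOpen_unitBall hu (z := z) (r := d / 2)
    (by linarith) (by linarith) hball (fun y _ => by positivity) fun y hy =>
      laplacian_norm_rpow_nonneg le_rfl
        (hh.contDiffAt (isOpen_unitBall.mem_nhds (hsubset hy))) (hsub y (hsubset hy) v)
  rw [finrank_real_Cn] at key
  simp only [Real.rpow_two] at key
  have hpt : ∀ y ∈ ball z (d / 2), ‖fderiv ℝ f y v‖ ^ 2 ≤ 2 * δ ^ 2 * ‖v‖ ^ 2 *
      (1 + d ^ (2 * n) * 2 ^ γ * ((1 - ‖y‖) ^ γ * normD f y ^ α)) := by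
    intro y hy
    rw [mem_ball, dist_eq_norm] at hy
    refine norm_fderiv_apply_sq_le_of_le hγ hα hd0 ?_ f v
    have := norm_le_norm_add_norm_sub z y
    rw [norm_sub_rev] at this
    linarith
  have hvol : volume.real (ball z (d / 2)) = (d / 2) ^ (2 * n) * ω := by
    rw [measureReal_def, Measure.addHaar_ball_of_pos _ _ (by linarith), finrank_real_Cn,
      ENNReal.toReal_mul, ENNReal.toReal_ofReal (by positivity)]
    rfl
  have hintB := hint.mono_set hsubset
  have hconst : IntegrableOn (fun _ : Cn n => (1 : ℝ)) (ball z (d / 2)) :=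
    integrableOn_const measure_ball_lt_top.ne
  have hle : ∫ y in ball z (d / 2), ‖fderiv ℝ f y v‖ ^ 2
      ≤ 2 * δ ^ 2 * ‖v‖ ^ 2 * ((d / 2) ^ (2 * n) * ω + d ^ (2 * n) * 2 ^ γ * J) := by
    have hmono : ∫ y in ball z (d / 2), (1 - ‖y‖) ^ γ * normD f y ^ α ≤ J := by
      refine setIntegral_mono_set hint ?_ hsubset.eventuallyLE
      filter_upwards [ae_restrict_mem isOpen_unitBall.measurableSet] with y hy using hpos y hy
    calc _ ≤ ∫ y in ball z (d / 2), 2 * δ ^ 2 * ‖v‖ ^ 2 *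
          (1 + d ^ (2 * n) * 2 ^ γ * ((1 - ‖y‖) ^ γ * normD f y ^ α)) := by
          refine integral_mono_of_nonneg (Eventually.of_forall fun y => by positivity)
            ((hconst.add (hintB.const_mul _)).const_mul _) ?_
          filter_upwards [ae_restrict_mem measurableSet_ball] with y hy using hpt y hy
      _ = 2 * δ ^ 2 * ‖v‖ ^ 2 * ((d / 2) ^ (2 * n) * ω + d ^ (2 * n) * 2 ^ γ *
          ∫ y in ball z (d / 2), (1 - ‖y‖) ^ γ * normD f y ^ α) := by
          rw [integral_const_mul, integral_add hconst (hintB.const_mul _), integral_const_mul,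
            setIntegral_const, hvol, smul_eq_mul, mul_one]
      _ ≤ _ := by gcongr
  have hfin : ‖fderiv ℝ f z v‖ ^ 2 ≤ K * (δ * ‖v‖) ^ 2 := by
    have hr : 0 < (d / 2) ^ (2 * n) := by positivity
    have h7 : d ^ (2 * n) = (d / 2) ^ (2 * n) * 2 ^ (2 * n) := by
      rw [← mul_pow]; congr 1; ring
    have h8 := key.trans hle
    rw [h7, show 2 * δ ^ 2 * ‖v‖ ^ 2 * ((d / 2) ^ (2 * n) * ω
      + (d / 2) ^ (2 * n) * 2 ^ (2 * n) * 2 ^ γ * J) = (d / 2) ^ (2 * n) *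
      ((δ * ‖v‖) ^ 2 * (2 * (ω + 2 ^ (2 * n) * 2 ^ γ * J))) by ring] at h8
    have h9 := le_of_mul_le_mul_left h8 hr
    rw [← le_div_iff₀ hκ] at h9
    refine h9.trans (le_of_eq ?_)
    rw [hK]
    ring
  have hb : 0 ≤ √K * δ * ‖v‖ :=
    mul_nonneg (mul_nonneg (Real.sqrt_nonneg _) hδ0.le) (norm_nonneg _)
  refine (sq_le_sq₀ (norm_nonneg _) hb).1 (hfin.trans_eq ?_)
  rw [mul_assoc, mul_pow (√K), Real.sq_sqrt hK0]

/-- Growth of a function in terms of the growth of its gradient. -/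
theorem norm_le_of_norm_fderiv_apply_le {f : Cn n → ℂ} {C q : ℝ} (hq : 0 < q) (hC : 0 ≤ C)
    (hf : DifferentiableOn ℝ f (unitBall n))
    (hD : ∀ z ∈ unitBall n, ∀ v, ‖fderiv ℝ f z v‖ ≤ C * (1 - ‖z‖) ^ (-(q + 1)) * ‖v‖)
    {z : Cn n} (hz : z ∈ unitBall n) :
    ‖f z‖ ≤ (‖f 0‖ + C / q) * (1 - ‖z‖) ^ (-q) := by
  have hz1 := mem_unitBall.1 hz
  have hnorm : ∀ t ∈ Icc (0 : ℝ) 1, ‖t • z‖ = t * ‖z‖ ∧ t * ‖z‖ ≤ ‖z‖ := fun t ht =>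
    ⟨by rw [norm_smul, Real.norm_of_nonneg ht.1], mul_le_of_le_one_left (norm_nonneg _) ht.2⟩
  have hmem : ∀ t ∈ Icc (0 : ℝ) 1, t • z ∈ unitBall n := fun t ht => by
    rw [mem_unitBall, (hnorm t ht).1]
    linarith [(hnorm t ht).2]
  have hφ : ∀ t ∈ Icc (0 : ℝ) 1,
      HasDerivAt (fun t : ℝ => f (t • z)) (fderiv ℝ f (t • z) z) t := by
    intro t ht
    have h1 : HasDerivAt (fun s : ℝ => s • z) z t := by
      simpa using (hasDerivAt_id t).smul_const z
    exact ((hf _ (hmem t ht)).differentiableAt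
      (isOpen_unitBall.mem_nhds (hmem t ht))).hasFDerivAt.comp_hasDerivAt t h1
  -- The barrier is a primitive of the gradient bound along the segment from 0 to z, so it dominates
  -- `‖f (t • z)‖`.
  have hB : ∀ t ∈ Icc (0 : ℝ) 1,
      HasDerivAt (fun t : ℝ => ‖f 0‖ + C / q * (1 - t * ‖z‖) ^ (-q))
        (C * (1 - t * ‖z‖) ^ (-(q + 1)) * ‖z‖) t := by
    intro t ht
    have hpos : 0 < 1 - t * ‖z‖ := by linarith [(hnorm t ht).2]
    have h1 : HasDerivAt (fun t : ℝ => 1 - t * ‖z‖) (-‖z‖) t := by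
      simpa using ((hasDerivAt_id t).mul_const ‖z‖).const_sub 1
    refine (((h1.rpow_const (p := -q) (.inl hpos.ne')).const_mul (C / q)).const_add
      ‖f 0‖).congr_deriv ?_
    rw [show -q - 1 = -(q + 1) by ring]
    field_simp
  have hmain := image_norm_le_of_norm_deriv_right_le_deriv_boundary'
    (fun t ht => (hφ t ht).continuousAt.continuousWithinAt)
    (fun t ht => (hφ t (Ico_subset_Icc_self ht)).hasDerivWithinAt)
    (B := fun t : ℝ => ‖f 0‖ + C / q * (1 - t * ‖z‖) ^ (-q))
    (by simp; positivity)
    (fun t ht => (hB t ht).continuousAt.continuousWithinAt)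
    (fun t ht => (hB t (Ico_subset_Icc_self ht)).hasDerivWithinAt)
    (fun t ht => by
      have ht' := Ico_subset_Icc_self ht
      have := hD _ (hmem t ht') z
      rwa [(hnorm t ht').1] at this) (right_mem_Icc.2 zero_le_one)
  simp only [one_smul, one_mul] at hmain
  -- Lets the constant `‖f 0‖` be absorbed into the power.
  have h1 : 1 ≤ (1 - ‖z‖) ^ (-q) :=
    Real.one_le_rpow_of_pos_of_le_one_of_nonpos (by linarith) (by linarith [norm_nonneg z])
      (by linarith)
  nlinarith [norm_nonneg (f 0)]

end YukawaBall

/-! ### Integrability of the weighted Laplacian -/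

theorem mainTheorem10 (n : ℕ) (α γ τ η p : ℝ)
    (hα : 2 ≤ α) (hαn : α ≤ 2 * (n : ℝ)) (hγ : 0 < γ)
    (hτ : 0 ≤ τ) (hη : 0 ≤ η) (hp : 2 ≤ p)
    (f : YukawaBall.Cn n → ℂ)
    (hHeinz : YukawaBall.MemHeinz 3 f)
    (hDir : YukawaBall.MemDirichlet γ α f)
    (hYuk : YukawaBall.SolvesYukawa (fun _ => τ) (fun _ => η) f) :
    ContDiffOn ℝ 2 (fun z => ‖f z‖ ^ p) (YukawaBall.unitBall n) ∧
      MeasureTheory.Integrable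
        (fun z => YukawaBall.distBdry z ^ (p * ((2 * (n : ℝ) + γ) / α - 1))
          * Laplacian.laplacian (fun w => ‖f w‖ ^ p) z)
        (YukawaBall.normVol n) := by
  open YukawaBall in
  have hC2 : ContDiffOn ℝ 2 (fun z => ‖f z‖ ^ p) (unitBall n) :=
    (contDiff_two_norm_rpow hp).comp_contDiffOn hYuk.1
  refine ⟨hC2, ?_⟩
  have hα0 : 0 < α := by linarith
  have hn : 1 ≤ n := by
    have : (0 : ℝ) < n := by linarith
    exact_mod_cast this
  have hf3 : ContDiffOn ℝ 3 f (unitBall n) := hHeinz.1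
  have hint := integrableOn_of_memDirichlet hn hγ.le hα0 hDir
  obtain ⟨C, hC, hgrad⟩ := exists_norm_fderiv_apply_le hγ.le hα hf3
    (fun z hz v => inner_fderiv_laplacian_nonneg hτ hη hf3 hYuk hz v) hint
  set q := (2 * (n : ℝ) + γ) / α - 1 with hq
  -- Equivalent to α ≤ 2n; it gives both q > 0 and the comparison of weights in `hDD`.
  have hqγ : γ / α ≤ q := by
    rw [hq, le_sub_iff_add_le, div_add_one hα0.ne', div_le_div_iff_of_pos_right hα0]
    linarith
  have hq0 : 0 < q := lt_of_lt_of_le (by positivity) hqγ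
  have hgrow := fun z hz => norm_le_of_norm_fderiv_apply_le (f := f) (C := C) hq0 hC
    (hYuk.1.differentiableOn (by simp)) (by simpa [hq] using hgrad) (z := z) hz
  set B := ‖f 0‖ + C / q with hBdef
  have hB : 0 ≤ B := by positivity
  rw [integrable_normVol_iff]
  set A₁ := p * (p - 1) * Module.finrank ℝ (Cn n) with hA₁
  set A₂ := p * (τ + η) with hA₂
  have hA₁0 : 0 ≤ A₁ := by
    have : 0 ≤ p - 1 := by linarith
    positivity
  have hA₂0 : 0 ≤ A₂ := by positivity
  have hconst : MeasureTheory.IntegrableOn (fun _ : Cn n => (1 : ℝ)) (unitBall n) :=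
    MeasureTheory.integrableOn_const volume_unitBall_lt_top.ne
  refine MeasureTheory.Integrable.mono'
    (((hconst.add hint).const_mul (A₁ * B ^ (p - 2) * 2)).add (hconst.const_mul (A₂ * B ^ p))) ?_ ?_
  · refine ContinuousOn.aestronglyMeasurable ?_ isOpen_unitBall.measurableSet
    refine ContinuousOn.mul ?_ (continuousOn_laplacian isOpen_unitBall hC2)
    exact (Metric.continuous_infDist_pt _).continuousOn.rpow_const fun _ _ =>
      .inr (by positivity)
  · filter_upwards [MeasureTheory.ae_restrict_mem isOpen_unitBall.measurableSet] with z hz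
    have hz1 := mem_unitBall.1 hz
    rw [distBdry_eq hn hz, norm_mul, Real.norm_eq_abs, Real.norm_eq_abs]
    have hg := hgrow z hz
    have hD := normD_nonneg f z
    set d := 1 - ‖z‖ with hd
    have hd0 : 0 < d := by linarith
    have hd1 : d ≤ 1 := by linarith [norm_nonneg z]
    have hlap : ‖Laplacian.laplacian f z‖ ≤ (τ + η) * ‖f z‖ := by
      rw [hYuk.2 z hz]
      refine (norm_add_le _ _).trans ?_
      simp only [norm_mul, Complex.norm_real, Real.norm_of_nonneg hτ, Real.norm_of_nonneg hη]
      have := Complex.abs_re_le_norm (f z)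
      rw [Real.norm_eq_abs, add_mul]
      gcongr
    have hΔ := abs_laplacian_norm_rpow_le hp
      (hYuk.1.contDiffAt (isOpen_unitBall.mem_nhds hz)) hlap (norm_fderiv_apply_sq_le f z)
    rw [← hA₁, ← hA₂] at hΔ
    have hfB : d ^ q * ‖f z‖ ≤ B := by
      rw [Real.rpow_neg hd0.le, ← div_eq_mul_inv, le_div_iff₀ (by positivity)] at hg
      linarith
    have hpow : ∀ s : ℝ, 0 ≤ s → d ^ (s * q) * ‖f z‖ ^ s ≤ B ^ s := fun s hs => by
      rw [mul_comm s q, Real.rpow_mul hd0.le, ← Real.mul_rpow (by positivity) (norm_nonneg _)]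
      exact Real.rpow_le_rpow (by positivity) hfB hs
    -- Since d ≤ 1 and q ≥ γ/α, d^{2q} ≤ (d^{γ/α})²; the elementary inequality with x = d^{γ/α}‖D_f‖
    -- then recovers the energy density.
    have hDD : d ^ (2 * q) * normD f z ^ 2 ≤ 1 + d ^ γ * normD f z ^ α := by
      have h1 := sq_le_one_add_rpow (x := d ^ (γ / α) * normD f z) (by positivity) hα
      rw [Real.mul_rpow (by positivity) hD, ← Real.rpow_mul hd0.le, div_mul_cancel₀ _ hα0.ne',
        mul_pow] at h1
      refine le_trans ?_ h1
      gcongr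
      rw [← Real.rpow_natCast, ← Real.rpow_mul hd0.le]
      refine Real.rpow_le_rpow_of_exponent_ge hd0 hd1 ?_
      push_cast
      linarith
    rw [abs_of_nonneg (by positivity)]
    -- The weight is shared out: (p - 2)q compensates |f|^{p-2}, and 2q compensates the squared
    -- gradient.
    have hsplit : d ^ (p * q) = d ^ ((p - 2) * q) * d ^ (2 * q) := by
      rw [← Real.rpow_add hd0]
      congr 1
      ring
    calc d ^ (p * q) * |Laplacian.laplacian (fun w => ‖f w‖ ^ p) z|
        ≤ d ^ (p * q) * (A₁ * (‖f z‖ ^ (p - 2) * (2 * normD f z ^ 2)) + A₂ * ‖f z‖ ^ p) := by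
          gcongr
      _ = A₁ * (d ^ ((p - 2) * q) * ‖f z‖ ^ (p - 2)) * 2 * (d ^ (2 * q) * normD f z ^ 2)
          + A₂ * (d ^ (p * q) * ‖f z‖ ^ p) := by
          rw [mul_add, hsplit]
          ring
      _ ≤ A₁ * B ^ (p - 2) * 2 * (1 + d ^ γ * normD f z ^ α) + A₂ * B ^ p := by
          have h1 := hpow (p - 2) (by linarith)
          have h2 := hpow p (by linarith)
          gcongr
      _ = _ := by simp [hd]
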